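/- A triangular configuration is a finite two-dimensional geometric simplicial complex $\Delta$ (a finite set of simplices in some $\mathbb{R}^m$, closed under taking faces, any two of which meet in a common face or not at all) in which every maximal simplex is a triangle or a segment. Its cycle space $\ker\Delta$ over $GF(2)$ is the kernel of the edge–triangle incidence matrix of $\Delta$, viewed as a linear code whose coordinates are indexed by the triangles of $\Delta$. A binary linear code $\mathcal{C}\subseteq GF(2)^n$ has $\Delta$ as a geometric representation if, for some set $S$ of triangles of $\Delta$ and some bijection between $\{1,\dots,n\}$ and the triangles not in $S$, the code obtained from $\ker\Delta$ by deleting the coordinates in $S$ equals $\mathcal{C}$ under this bijection, and $\dim\mathcal{C}=\dim\ker\Delta$. Theorem 4. Every binary linear code $\mathcal{C}\subseteq GF(2)^n$ has a geometric representation embeddable into $\mathbb{R}^4$; more precisely, it has a geometric representation $\Delta$ whose simplices are (straight) simplices in $\mathbb{R}^4$. -/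

import Mathlib

/-- Puncturing a linear code `K ⊆ F^ι` along a set `S` of coordinates: the entries indexed by
the elements of `S` are deleted from every codeword. -/
def punctured {F : Type*} [Field F] {ι : Type*} (K : Submodule F (ι → F)) (S : Set ι) :
    Submodule F ({i : ι // i ∉ S} → F) :=
  K.map (LinearMap.funLeft F F (Subtype.val : {i : ι // i ∉ S} → ι))

/-- A triangular configuration in `ℝ^m`: a finite geometric simplicial complex of dimension two,
made of (affine, straight) simplices in `ℝ^m`, each of whose maximal simplices is a triangle or a
segment. A simplex is recorded by its set of vertices, so a set of `k + 1` vertices is a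
`k`-dimensional simplex. -/
structure TriangularConfiguration (m : ℕ)
    extends Geometry.SimplicialComplex ℝ (EuclideanSpace ℝ (Fin m)) where
  finite_faces : faces.Finite
  dim_eq_two : IsGreatest {k : ℕ | ∃ s ∈ faces, s.card = k + 1} 2
  card_facets : ∀ s ∈ toSimplicialComplex.facets, s.card = 2 ∨ s.card = 3

namespace TriangularConfiguration

variable {m : ℕ} (Δ : TriangularConfiguration m)

/-- The edges (one-dimensional simplices). -/
def Edge : Type := {s : Finset (EuclideanSpace ℝ (Fin m)) // s ∈ Δ.faces ∧ s.card = 2}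

/-- The triangles (two-dimensional simplices). -/
def Triangle : Type := {s : Finset (EuclideanSpace ℝ (Fin m)) // s ∈ Δ.faces ∧ s.card = 3}

instance : Finite Δ.Triangle :=
  (Δ.finite_faces.subset (fun _ h => h.1) :
    {s : Finset (EuclideanSpace ℝ (Fin m)) | s ∈ Δ.faces ∧ s.card = 3}.Finite).to_subtype

noncomputable instance : Fintype Δ.Triangle := Fintype.ofFinite _

open Classical in
/-- The incidence matrix over `F`: rows are indexed by edges, columns by triangles. -/
noncomputable def incidenceMatrix (F : Type*) [Field F] : Matrix Δ.Edge Δ.Triangle F :=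
  Matrix.of fun e t => if e.1 ⊆ t.1 then 1 else 0

/-- The cycle space `ker Δ` over `F`: the kernel of the incidence matrix, a linear code whose
coordinates are indexed by the triangles. -/
noncomputable def cycleSpace (F : Type*) [Field F] : Submodule F (Δ.Triangle → F) :=
  LinearMap.ker (Δ.incidenceMatrix F).mulVecLin

/-- `Δ` is a geometric representation of the code `C ⊆ F^n`: for some set `S` of triangles, `C` is
the cycle space punctured along `S` (the coordinates `0, …, n - 1` of `C` being matched by a
bijection `e` with the triangles that remain), and both have the same dimension. -/
def IsGeometricRepresentation {F : Type*} [Field F] {n : ℕ} (C : Submodule F (Fin n → F)) :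
    Prop :=
  (∃ (S : Set Δ.Triangle) (e : Fin n ≃ {t : Δ.Triangle // t ∉ S}),
      C = (punctured (Δ.cycleSpace F) S).map (LinearMap.funLeft F F e)) ∧
    Module.finrank F C = Module.finrank F (Δ.cycleSpace F)

end TriangularConfiguration

/-! Let `b` be a basis of the code, with the zero word added as an extra row. Every row gets a
circuit through `0, 2, …, 2 n + 4` that detours through `2 i + 1` exactly when entry `i` of the row
is nonzero, and a cone over it with its own apex. For every coordinate `i` the ear `{2 i, 2 i + 1, 2
i + 2}` fills the gap between the detour and the direct edge. Edges at an apex force a cycle to be a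
constant `c j` on cone `j`. The edge `{0, 2 n + 4}` lies once in every cone, so `∑ j, c j = 0`; the
edge `{2 i, 2 i + 1}` shows that ear `i` carries the combination `∑ j, c j * r j i`. Conversely
every such `c` gives a cycle. The zero row absorbs the parity condition, so the cycle space projects
isomorphically onto the code along the ears. For the embedding, the vertices go on the moment curve
in `ℝ⁴`. Any five of its points are affinely independent, and in a dependence of six points
consecutive signs are opposite; hence two triangles can meet badly only if their vertices alternate.
The chosen order of the vertices excludes this (`not_alternate_coneFamily`). -/

/-! ### Simplices on the moment curve -/

/-- Two vertex sets alternate if they contain six points `a < a' < b < b' < c < c'`, the unprimed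
ones in the first set and the primed ones in the second. -/
def Alternate (s t : Finset ℕ) : Prop :=
  ∃ a ∈ s, ∃ a' ∈ t, ∃ b ∈ s, ∃ b' ∈ t, ∃ c ∈ s, ∃ c' ∈ t,
    a < a' ∧ a' < b ∧ b < b' ∧ b' < c ∧ c < c'

/-- The points with natural parameters on the moment curve in `ℝ⁴`. -/
noncomputable def momentCurve (m : ℕ) : EuclideanSpace ℝ (Fin 4) :=
  WithLp.toLp 2 fun i => (m : ℝ) ^ (i.1 + 1)

theorem momentCurve_injective : Function.Injective momentCurve := by
  intro a b h
  have := congrFun (congrArg WithLp.ofLp h) 0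
  simpa [momentCurve] using this

open Polynomial in
theorem sum_mul_eval_eq_zero_of_momentCurve {U : Finset ℕ} {f : ℕ → ℝ} (h0 : ∑ m ∈ U, f m = 0)
    (h1 : ∑ m ∈ U, f m • momentCurve m = 0) {p : ℝ[X]} (hp : p.natDegree ≤ 4) :
    ∑ m ∈ U, f m * p.eval (m : ℝ) = 0 := by
  have key : ∀ k < 5, ∑ m ∈ U, f m * (m : ℝ) ^ k = 0 := by
    intro k hk
    rcases k with _ | k
    · simpa using h0
    · have := congrFun (congrArg WithLp.ofLp h1) ⟨k, by omega⟩
      simpa [momentCurve] using this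
  simp_rw [eval_eq_sum_range' (Nat.lt_succ_of_le hp), Finset.mul_sum]
  rw [Finset.sum_comm]
  refine Finset.sum_eq_zero fun k hk => ?_
  rw [Finset.sum_congr rfl fun m _ => mul_left_comm (f m) (p.coeff k) _, ← Finset.mul_sum,
    key k (by simpa using hk), mul_zero]

-- Testing the dependence against the polynomial of degree at most 4 that vanishes at all the other
-- points isolates `f m`.
open Polynomial in
theorem eq_zero_of_momentCurve_dependence {U : Finset ℕ} (hU : U.card ≤ 5) {f : ℕ → ℝ}
    (h0 : ∑ m ∈ U, f m = 0) (h1 : ∑ m ∈ U, f m • momentCurve m = 0) {m : ℕ} (hm : m ∈ U) :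
    f m = 0 := by
  have h := sum_mul_eval_eq_zero_of_momentCurve h0 h1
    (p := ∏ k ∈ U.erase m, (X - C (k : ℝ))) (by
      rw [natDegree_finsetProd_X_sub_C_eq_card]
      have := Finset.card_erase_of_mem hm
      omega)
  rw [Finset.sum_eq_single_of_mem m hm] at h
  · refine (mul_eq_zero.1 h).resolve_right ?_
    rw [eval_prod]
    refine Finset.prod_ne_zero_iff.2 ?_
    intro k hk
    have : (m : ℝ) ≠ k := by exact_mod_cast (Finset.ne_of_mem_erase hk).symm
    simpa [sub_eq_zero] using this
  · intro k hk hkm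
    rw [eval_prod, Finset.prod_eq_zero (Finset.mem_erase.2 ⟨hkm, hk⟩) (by simp), mul_zero]

-- A polynomial of degree at most 4 vanishing at all points but `x` and `y` has the same sign at
-- both, because no root lies between them; the dependence then reads `f x * p x + f y * p y = 0`.
open Polynomial in
theorem mul_nonpos_of_momentCurve_dependence {U : Finset ℕ} (hU : U.card ≤ 6) {f : ℕ → ℝ}
    (h0 : ∑ m ∈ U, f m = 0) (h1 : ∑ m ∈ U, f m • momentCurve m = 0) {x y : ℕ} (hx : x ∈ U)
    (hy : y ∈ U) (hxy : x < y) (hcons : ∀ k ∈ U, k ≤ x ∨ y ≤ k) : f x * f y ≤ 0 := by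
  have hy' : y ∈ U.erase x := Finset.mem_erase.2 ⟨hxy.ne', hy⟩
  set W := (U.erase x).erase y with hW
  set p : ℝ[X] := ∏ k ∈ W, (X - C (k : ℝ)) with hp
  have h := sum_mul_eval_eq_zero_of_momentCurve h0 h1 (p := p) (by
      rw [natDegree_finsetProd_X_sub_C_eq_card]
      have := Finset.card_erase_of_mem hx
      have : W.card = (U.erase x).card - 1 := Finset.card_erase_of_mem hy'
      omega)
  have hpos : 0 < p.eval (x : ℝ) * p.eval (y : ℝ) := by
    rw [hp, eval_prod, eval_prod, ← Finset.prod_mul_distrib]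
    refine Finset.prod_pos fun k hk => ?_
    simp only [hW, Finset.mem_erase] at hk
    simp only [eval_sub, eval_X, eval_C]
    rcases hcons k hk.2.2 with hkx | hky
    · have h1 : (k : ℝ) < x := by exact_mod_cast lt_of_le_of_ne hkx hk.2.1
      have h2 : (x : ℝ) < y := by exact_mod_cast hxy
      exact mul_pos (by linarith) (by linarith)
    · have h1 : (y : ℝ) < k := by exact_mod_cast lt_of_le_of_ne hky (Ne.symm hk.1)
      have h2 : (x : ℝ) < y := by exact_mod_cast hxy
      exact mul_pos_of_neg_of_neg (by linarith) (by linarith)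
  rw [← Finset.add_sum_erase _ _ hx, ← Finset.add_sum_erase _ _ hy', ← hW,
    Finset.sum_eq_zero (s := W), add_zero] at h
  · have h2 : f x * f y * (p.eval (x : ℝ) * p.eval (y : ℝ)) = -(f x * p.eval (x : ℝ)) ^ 2 := by
      have : f y * p.eval (y : ℝ) = -(f x * p.eval (x : ℝ)) := by linarith
      calc _ = f x * p.eval (x : ℝ) * (f y * p.eval (y : ℝ)) := by ring
        _ = _ := by rw [this]; ring
    by_contra! hc
    have := mul_pos hc hpos
    nlinarith [sq_nonneg (f x * p.eval (x : ℝ))]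
  · intro k hk
    rw [hp, eval_prod, Finset.prod_eq_zero hk (by simp), mul_zero]

theorem affineIndependent_momentCurve {s : Finset ℕ} (hs : s.card ≤ 5) :
    AffineIndependent ℝ
      ((↑) : {x // x ∈ s.image momentCurve} → EuclideanSpace ℝ (Fin 4)) := by
  have h : AffineIndependent ℝ fun m : s => momentCurve m := by
    rw [affineIndependent_iff]
    intro t w h0 h1 m hm
    classical
    let f : ℕ → ℝ := fun k => if hk : k ∈ s then w ⟨k, hk⟩ else 0
    have hf : ∀ k : s, f k = w k := fun k => by simp [f]
    have hcard : (t.map (Function.Embedding.subtype _)).card ≤ 5 := by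
      rw [Finset.card_map]
      have h := Finset.card_le_univ t
      rw [Fintype.card_coe] at h
      exact h.trans hs
    have := eq_zero_of_momentCurve_dependence (f := f) hcard (by simpa [hf] using h0)
      (by simpa [hf] using h1) (m := m) (by simpa using hm)
    rwa [hf] at this
  have h2 := h.range
  have e : Set.range (fun m : s => momentCurve m) = (s.image momentCurve : Finset _) := by
    ext x; simp
  rw [e] at h2
  exact h2

/-- Neighbours in the increasing list of the six points have nothing between them, so they cannot
lie in the same set. -/
theorem exists_alternate_of_card_union_eq_six {s t : Finset ℕ} (hcard : (s ∪ t).card = 6)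
    (hs : ∀ x ∈ s, ∀ y ∈ s, x < y → ∃ k ∈ s ∪ t, x < k ∧ k < y)
    (ht : ∀ x ∈ t, ∀ y ∈ t, x < y → ∃ k ∈ s ∪ t, x < k ∧ k < y) :
    Alternate s t ∨ Alternate t s := by
  set u := (s ∪ t).orderEmbOfFin hcard with hu
  have hmem : ∀ i, u i ∈ s ∨ u i ∈ t := fun i =>
    Finset.mem_union.1 ((s ∪ t).orderEmbOfFin_mem hcard i)
  have hlt : ∀ i j, i < j → u i < u j := fun i j h => u.strictMono h
  have hno : ∀ i j : Fin 6, j.1 = i.1 + 1 → ¬ ∃ k ∈ s ∪ t, u i < k ∧ k < u j := by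
    rintro i j hij ⟨k, hk, h1, h2⟩
    have hk' : k ∈ Set.range u := by rw [hu, Finset.range_orderEmbOfFin]; exact hk
    obtain ⟨l, rfl⟩ := hk'
    have h1 := u.lt_iff_lt.1 h1
    have h2 := u.lt_iff_lt.1 h2
    rw [Fin.lt_def] at h1 h2
    omega
  have hs' : ∀ i j : Fin 6, j.1 = i.1 + 1 → u i ∈ s → u j ∈ t := fun i j hij hi =>
    (hmem j).resolve_left fun hj =>
      hno i j hij (hs _ hi _ hj (hlt _ _ (by rw [Fin.lt_def]; omega)))
  have ht' : ∀ i j : Fin 6, j.1 = i.1 + 1 → u i ∈ t → u j ∈ s := fun i j hij hi =>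
    (hmem j).resolve_right fun hj =>
      hno i j hij (ht _ hi _ hj (hlt _ _ (by rw [Fin.lt_def]; omega)))
  rcases hmem 0 with h0 | h0
  · have h1 := hs' 0 1 rfl h0
    have h2 := ht' 1 2 rfl h1
    have h3 := hs' 2 3 rfl h2
    have h4 := ht' 3 4 rfl h3
    have h5 := hs' 4 5 rfl h4
    exact Or.inl ⟨_, h0, _, h1, _, h2, _, h3, _, h4, _, h5, hlt _ _ (by decide),
      hlt _ _ (by decide), hlt _ _ (by decide), hlt _ _ (by decide), hlt _ _ (by decide)⟩
  · have h1 := ht' 0 1 rfl h0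
    have h2 := hs' 1 2 rfl h1
    have h3 := ht' 2 3 rfl h2
    have h4 := hs' 3 4 rfl h3
    have h5 := ht' 4 5 rfl h4
    exact Or.inr ⟨_, h0, _, h1, _, h2, _, h3, _, h4, _, h5, hlt _ _ (by decide),
      hlt _ _ (by decide), hlt _ _ (by decide), hlt _ _ (by decide), hlt _ _ (by decide)⟩

/-- The difference of two convex representations of a common point is an affine dependence on `s ∪
t`. If it vanishes, the weights agree and live on `s ∩ t`. Otherwise `s` and `t` are disjoint
triples, the signs are positive on `s` and negative on `t`, and the sign rule makes them alternate.
-/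
theorem convexHull_momentCurve_inter_subset {s t : Finset ℕ} (hs : s.card ≤ 3) (ht : t.card ≤ 3)
    (hst : ¬ Alternate s t) (hts : ¬ Alternate t s) :
    convexHull ℝ (momentCurve '' s) ∩ convexHull ℝ (momentCurve '' t) ⊆
      convexHull ℝ (momentCurve '' (s ∩ t : Finset ℕ)) := by
  classical
  rintro x ⟨hxs, hxt⟩
  have weights : ∀ u : Finset ℕ, x ∈ convexHull ℝ (momentCurve '' u) →
      ∃ w : ℕ → ℝ, (∀ m, 0 ≤ w m) ∧ (∀ m ∉ u, w m = 0) ∧ ∑ m ∈ u, w m = 1 ∧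
        ∑ m ∈ u, w m • momentCurve m = x := by
    intro u hu
    rw [← Finset.coe_image, Finset.mem_convexHull'] at hu
    obtain ⟨w, h0, h1, h2⟩ := hu
    rw [Finset.sum_image momentCurve_injective.injOn] at h1 h2
    refine ⟨fun m => if m ∈ u then w (momentCurve m) else 0, fun m => ?_, fun m hm => by simp [hm],
      ?_, ?_⟩
    · dsimp only
      split_ifs with hm
      · exact h0 _ (Finset.mem_image_of_mem _ hm)
      · exact le_rfl
    · rw [← h1]
      exact Finset.sum_congr rfl fun m hm => by simp [hm]
    · rw [← h2]
      exact Finset.sum_congr rfl fun m hm => by simp [hm]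
  obtain ⟨v, hv0, hvs, hv1, hvx⟩ := weights s hxs
  obtain ⟨w, hw0, hwt, hw1, hwx⟩ := weights t hxt
  have extS : ∀ {M : Type} [AddCommMonoid M] (g : ℕ → M), (∀ m ∉ s, g m = 0) →
      ∑ m ∈ s ∪ t, g m = ∑ m ∈ s, g m := fun g hg =>
    (Finset.sum_subset Finset.subset_union_left fun m _ hm => hg m hm).symm
  have extT : ∀ {M : Type} [AddCommMonoid M] (g : ℕ → M), (∀ m ∉ t, g m = 0) →
      ∑ m ∈ s ∪ t, g m = ∑ m ∈ t, g m := fun g hg =>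
    (Finset.sum_subset Finset.subset_union_right fun m _ hm => hg m hm).symm
  have h0 : ∑ m ∈ s ∪ t, (v m - w m) = 0 := by
    rw [Finset.sum_sub_distrib, extS v hvs, extT w hwt, hv1, hw1, sub_self]
  have h1 : ∑ m ∈ s ∪ t, (v m - w m) • momentCurve m = 0 := by
    simp_rw [sub_smul]
    rw [Finset.sum_sub_distrib, extS (fun m => v m • momentCurve m),
      extT (fun m => w m • momentCurve m),
      hvx, hwx, sub_self]
    · intro m hm; simp [hwt m hm]
    · intro m hm; simp [hvs m hm]

  have hle : (s ∪ t).card ≤ 6 := (Finset.card_union_le s t).trans (by omega)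
  have hvw : ∀ m, v m = w m := by
    suffices H : ∀ m ∈ s ∪ t, v m - w m = 0 by
      intro m
      by_cases hm : m ∈ s ∪ t
      · linarith [H m hm]
      · rw [Finset.mem_union, not_or] at hm
        rw [hvs m hm.1, hwt m hm.2]
    by_contra! hne
    obtain ⟨m₀, hm₀, hne⟩ := hne
    have hcard : (s ∪ t).card = 6 := by
      by_contra hc
      exact hne (eq_zero_of_momentCurve_dependence (f := fun m => v m - w m) (by omega) h0 h1 hm₀)
    have hdisj : Disjoint s t := by
      rw [Finset.disjoint_iff_inter_eq_empty, ← Finset.card_eq_zero]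
      have := Finset.card_union_add_card_inter s t
      omega
    -- A vanishing coefficient would leave a nontrivial dependence on five points.
    have hne' : ∀ m ∈ s ∪ t, v m - w m ≠ 0 := by
      intro m hm hz
      have e0 : ∑ k ∈ (s ∪ t).erase m, (v k - w k) = 0 := by
        rw [Finset.sum_erase (f := fun k => v k - w k) _ hz, h0]
      have e1 : ∑ k ∈ (s ∪ t).erase m, (v k - w k) • momentCurve k = 0 := by
        rw [Finset.sum_erase (f := fun k => (v k - w k) • momentCurve k) _
          (by rw [hz, zero_smul]), h1]
      have hmm : m₀ ∈ (s ∪ t).erase m :=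
        Finset.mem_erase.2 ⟨fun h => hne (h ▸ hz), hm₀⟩
      refine hne (eq_zero_of_momentCurve_dependence (f := fun m => v m - w m) ?_ e0 e1 hmm)
      rw [Finset.card_erase_of_mem hm, hcard]
    have hpos : ∀ m ∈ s, 0 < v m - w m := by
      intro m hm
      have hw : w m = 0 := hwt m (Finset.disjoint_left.1 hdisj hm)
      have := hne' m (Finset.mem_union_left _ hm)
      rw [hw, sub_zero] at this ⊢
      exact lt_of_le_of_ne (hv0 m) this.symm
    have hneg : ∀ m ∈ t, v m - w m < 0 := by
      intro m hm
      have hv : v m = 0 := hvs m (Finset.disjoint_right.1 hdisj hm)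
      have := hne' m (Finset.mem_union_right _ hm)
      rw [hv, zero_sub] at this ⊢
      exact lt_of_le_of_ne (neg_nonpos.2 (hw0 m)) this
    have hs' : ∀ x ∈ s, ∀ y ∈ s, x < y → ∃ k ∈ s ∪ t, x < k ∧ k < y := by
      intro x hx y hy hxy
      by_contra! hk
      have := mul_nonpos_of_momentCurve_dependence (f := fun m => v m - w m) hle h0 h1
        (Finset.mem_union_left _ hx) (Finset.mem_union_left _ hy) hxy
        fun k hk' => (le_or_gt k x).imp_right (hk k hk')
      exact absurd (mul_pos (hpos x hx) (hpos y hy)) (not_lt.2 this)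
    have ht' : ∀ x ∈ t, ∀ y ∈ t, x < y → ∃ k ∈ s ∪ t, x < k ∧ k < y := by
      intro x hx y hy hxy
      by_contra! hk
      have := mul_nonpos_of_momentCurve_dependence (f := fun m => v m - w m) hle h0 h1
        (Finset.mem_union_right _ hx) (Finset.mem_union_right _ hy) hxy
        fun k hk' => (le_or_gt k x).imp_right (hk k hk')
      exact absurd (mul_pos_of_neg_of_neg (hneg x hx) (hneg y hy)) (not_lt.2 this)
    exact (exists_alternate_of_card_union_eq_six hcard hs' ht').elim hst hts
  have hz : ∀ m ∈ s, m ∉ s ∩ t → v m = 0 := fun m hm hm' => by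
    rw [hvw]; exact hwt m fun h => hm' (Finset.mem_inter.2 ⟨hm, h⟩)
  rw [← hvx, ← Finset.sum_subset (Finset.inter_subset_left (s₁ := s) (s₂ := t))
    fun m hm hm' => by rw [hz m hm hm', zero_smul]]
  refine (convex_convexHull ℝ _).sum_mem (fun m _ => hv0 m) ?_ fun m hm =>
    subset_convexHull ℝ _ (Set.mem_image_of_mem _ (by exact_mod_cast hm))
  rw [Finset.sum_subset (Finset.inter_subset_left (s₁ := s) (s₂ := t)) hz, hv1]

/-! ### The configuration with prescribed triangles and its cycle space -/

/-- The triangular configuration in `ℝ⁴` with prescribed triangles, whose vertices lie on the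
moment curve, provided that no two of the triangles alternate. -/
noncomputable def momentConfiguration {I : Type*} [Finite I] [Nonempty I] (σ : I → Finset ℕ)
    (hcard : ∀ k, (σ k).card = 3) (halt : ∀ k l, ¬ Alternate (σ k) (σ l)) :
    TriangularConfiguration 4 where
  faces := {F | ∃ s : Finset ℕ, s.Nonempty ∧ (∃ k, s ⊆ σ k) ∧ s.image momentCurve = F}
  isRelLowerSet_faces := by
    rintro F ⟨s, hs, ⟨k, hk⟩, rfl⟩
    refine ⟨hs.image _, fun G hG hne => ?_⟩
    obtain ⟨t, hts, rfl⟩ := Finset.subset_image_iff.1 hG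
    exact ⟨t, by simpa using hne, ⟨k, Set.Subset.trans hts hk⟩, rfl⟩
  indep := by
    rintro F ⟨s, hs, ⟨k, hk⟩, rfl⟩
    exact affineIndependent_momentCurve
      ((Finset.card_le_card hk).trans ((hcard k).trans_le (by omega)))
  inter_subset_convexHull := by
    classical
    rintro F G ⟨s, hs, ⟨k, hk⟩, rfl⟩ ⟨t, ht, ⟨l, hl⟩, rfl⟩
    have hmono : ∀ {s t k l}, s ⊆ σ k → t ⊆ σ l → ¬ Alternate s t := by
      rintro s t k l hk hl ⟨a, ha, a', ha', b, hb, b', hb', c, hc, c', hc', h⟩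
      exact halt k l ⟨a, hk ha, a', hl ha', b, hk hb, b', hl hb', c, hk hc, c', hl hc', h⟩
    have h := convexHull_momentCurve_inter_subset
      ((Finset.card_le_card hk).trans (hcard k).le) ((Finset.card_le_card hl).trans (hcard l).le)
      (hmono hk hl) (hmono hl hk)
    rw [Finset.coe_inter, Set.image_inter momentCurve_injective] at h
    simpa only [Finset.coe_image] using h
  finite_faces := by
    classical
    refine (Set.finite_iUnion fun k =>
      ((σ k).powerset.image (Finset.image momentCurve)).finite_toSet).subset ?_
    rintro F ⟨s, hs, ⟨k, hk⟩, rfl⟩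
    exact Set.mem_iUnion.2 ⟨k, by
      simpa using ⟨s, hk, rfl⟩⟩
  dim_eq_two := by
    constructor
    · obtain ⟨k⟩ := ‹Nonempty I›
      refine ⟨_, ⟨σ k, ?_, ⟨k, subset_rfl⟩, rfl⟩, ?_⟩
      · rw [← Finset.card_pos, hcard]; omega
      · rw [Finset.card_image_of_injective _ momentCurve_injective, hcard]
    · rintro d ⟨F, ⟨s, hs, ⟨k, hk⟩, rfl⟩, hd⟩
      rw [Finset.card_image_of_injective _ momentCurve_injective] at hd
      have := Finset.card_le_card hk
      rw [hcard] at this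
      omega
  card_facets := by
    rintro F ⟨⟨s, hs, ⟨k, hk⟩, rfl⟩, hmax⟩
    right
    rw [hmax ⟨σ k, hs.mono hk, ⟨k, subset_rfl⟩, rfl⟩ (Finset.image_subset_image hk),
      Finset.card_image_of_injective _ momentCurve_injective, hcard]

section

variable {I : Type*} [Finite I] [Nonempty I] {σ : I → Finset ℕ}
  (hcard : ∀ k, (σ k).card = 3) (halt : ∀ k l, ¬ Alternate (σ k) (σ l))

/-- The triangles of `momentConfiguration` are indexed by the given family. -/
noncomputable def momentTriangleEquiv (hσ : Function.Injective σ) :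
    I ≃ (momentConfiguration σ hcard halt).Triangle :=
  Equiv.ofBijective
    (fun k => ⟨(σ k).image momentCurve,
      ⟨σ k, by rw [← Finset.card_pos, hcard]; omega, ⟨k, subset_rfl⟩, rfl⟩, by
        rw [Finset.card_image_of_injective _ momentCurve_injective, hcard]⟩) (by
    constructor
    · intro k l h
      exact hσ (Finset.image_injective momentCurve_injective (congrArg Subtype.val h))
    · rintro ⟨F, ⟨s, hs, ⟨k, hk⟩, rfl⟩, hF⟩
      rw [Finset.card_image_of_injective _ momentCurve_injective] at hF
      have : s = σ k := Finset.eq_of_subset_of_card_le hk (by rw [hF, hcard])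
      subst this
      exact ⟨k, rfl⟩)

theorem momentTriangleEquiv_val (hσ : Function.Injective σ) (k : I) :
    (momentTriangleEquiv hcard halt hσ k).1 = (σ k).image momentCurve := rfl

/-- Pairs that span no edge lie in no triangle and impose nothing, so all pairs `u < v` may be
tested. -/
theorem mem_cycleSpace_momentConfiguration [Fintype I] {F : Type*} [Field F]
    (hσ : Function.Injective σ) (x : (momentConfiguration σ hcard halt).Triangle → F) :
    x ∈ (momentConfiguration σ hcard halt).cycleSpace F ↔
      ∀ u v : ℕ, u < v → ∑ k, (if u ∈ σ k ∧ v ∈ σ k then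
        x (momentTriangleEquiv hcard halt hσ k) else 0) = 0 := by
  classical
  have hrow : ∀ (e : (momentConfiguration σ hcard halt).Edge) (u v : ℕ),
      e.1 = ({u, v} : Finset ℕ).image momentCurve →
      ((momentConfiguration σ hcard halt).incidenceMatrix F).mulVec x e =
        ∑ k, (if u ∈ σ k ∧ v ∈ σ k then x (momentTriangleEquiv hcard halt hσ k) else 0) := by
    intro e u v he
    rw [Matrix.mulVec, dotProduct, ← (momentTriangleEquiv hcard halt hσ).sum_comp]
    refine Finset.sum_congr rfl fun k _ => ?_
    have : e.1 ⊆ (momentTriangleEquiv hcard halt hσ k).1 ↔ u ∈ σ k ∧ v ∈ σ k := by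
      rw [he, momentTriangleEquiv_val, Finset.image_subset_image_iff momentCurve_injective,
        Finset.insert_subset_iff, Finset.singleton_subset_iff]
    simp [TriangularConfiguration.incidenceMatrix, this]
  rw [TriangularConfiguration.cycleSpace, LinearMap.mem_ker, Matrix.mulVecLin_apply, funext_iff]
  constructor
  · intro h u v huv
    by_cases hk : ∃ k, u ∈ σ k ∧ v ∈ σ k
    · obtain ⟨k, hu, hv⟩ := hk
      have hface : ({u, v} : Finset ℕ).image momentCurve ∈
          (momentConfiguration σ hcard halt).faces :=
        ⟨{u, v}, by simp, ⟨k, by simp [Finset.insert_subset_iff, hu, hv]⟩, rfl⟩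
      rw [← hrow ⟨_, hface, by
        rw [Finset.card_image_of_injective _ momentCurve_injective, Finset.card_pair huv.ne]⟩
        u v rfl]
      exact h _
    · exact Finset.sum_eq_zero fun k _ => if_neg fun hh => hk ⟨k, hh⟩
  · intro h e
    obtain ⟨s, hs, ⟨k, hk⟩, he⟩ := e.2.1
    have h2 : s.card = 2 := by
      rw [← e.2.2, ← he, Finset.card_image_of_injective _ momentCurve_injective]
    obtain ⟨u, v, huv, rfl⟩ := Finset.card_eq_two.1 h2
    rcases huv.lt_or_gt with huv | huv
    · rw [hrow e u v he.symm, h u v huv]; rfl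
    · rw [hrow e v u (by rw [Finset.pair_comm, he]), h v u huv]; rfl

/-- Reduction to linear algebra on the index set: `hmem` and `hsurj` identify the punctured code,
and `hinj` ensures that deleting the coordinates outside the range of `τ` loses no dimension. -/
theorem isGeometricRepresentation_momentConfiguration [Fintype I] {F : Type*} [Field F]
    (hσ : Function.Injective σ) {n : ℕ} (τ : Fin n → I) (hτ : Function.Injective τ)
    (C : Submodule F (Fin n → F))
    (hinj : ∀ x : I → F, (∀ u v : ℕ, u < v →
      ∑ k, (if u ∈ σ k ∧ v ∈ σ k then x k else 0) = 0) → (∀ i, x (τ i) = 0) → x = 0)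
    (hmem : ∀ x : I → F, (∀ u v : ℕ, u < v →
      ∑ k, (if u ∈ σ k ∧ v ∈ σ k then x k else 0) = 0) → (fun i => x (τ i)) ∈ C)
    (hsurj : ∀ y ∈ C, ∃ x : I → F, (∀ u v : ℕ, u < v →
      ∑ k, (if u ∈ σ k ∧ v ∈ σ k then x k else 0) = 0) ∧ ∀ i, x (τ i) = y i) :
    (momentConfiguration σ hcard halt).IsGeometricRepresentation C := by
  classical
  set Δ := momentConfiguration σ hcard halt
  set ε := momentTriangleEquiv hcard halt hσ
  let τ' : Fin n → Δ.Triangle := fun i => ε (τ i)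
  have hτ' : Function.Injective τ' := ε.injective.comp hτ
  have himg : C = (Δ.cycleSpace F).map (LinearMap.funLeft F F τ') := by
    ext y
    rw [Submodule.mem_map]
    constructor
    · intro hy
      obtain ⟨x, hx, hxy⟩ := hsurj y hy
      refine ⟨fun t => x (ε.symm t), ?_, ?_⟩
      · rw [mem_cycleSpace_momentConfiguration hcard halt hσ]
        simpa [ε] using hx
      · ext i
        simp [LinearMap.funLeft_apply, τ', hxy]
    · rintro ⟨x, hx, rfl⟩
      rw [mem_cycleSpace_momentConfiguration hcard halt hσ] at hx
      exact hmem (fun k => x (ε k)) hx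
  refine ⟨⟨(Set.range τ')ᶜ, (Equiv.ofInjective τ' hτ').trans
    (Equiv.subtypeEquivRight fun t => by simp), ?_⟩, ?_⟩
  · rw [punctured, ← Submodule.map_comp, himg]
    rfl
  · have hinj' : Set.InjOn (LinearMap.funLeft F F τ') (Δ.cycleSpace F) := by
      have := (LinearMap.disjoint_ker (f := LinearMap.funLeft F F τ')
        (p := Δ.cycleSpace F)).2 fun x hx h0 => by
          have h := hinj (fun k => x (ε k))
            ((mem_cycleSpace_momentConfiguration hcard halt hσ x).1 hx) fun i => congrFun h0 i
          ext t
          simpa using congrFun h (ε.symm t)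
      exact LinearMap.injOn_of_disjoint_ker subset_rfl this
    have e := Submodule.equivMapOfInjective ((LinearMap.funLeft F F τ').domRestrict (Δ.cycleSpace F))
      (by
        intro a b hab
        exact Subtype.ext (hinj' a.2 b.2 hab)) ⊤
    rw [himg, ← LinearMap.range_domRestrict, ← Submodule.map_top, ← e.finrank_eq, finrank_top]

end

/-! ### Circuits with detours -/

theorem eq_one_of_ne_zero_zmod_two {a : ZMod 2} (h : a ≠ 0) : a = 1 := Fin.eq_one_of_ne_zero a h

/-- Successor on the closed circuit through `0, 2, …, 2 n + 4` which, for every `i` with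
`r i ≠ 0`, makes a detour from `2 i` to `2 i + 2` through `2 i + 1`. -/
def circuitNext (n : ℕ) (r : ℕ → ZMod 2) (a : ℕ) : ℕ :=
  if a = 2 * n + 4 then 0 else if a % 2 = 0 ∧ r (a / 2) = 0 then a + 2 else a + 1

/-- The vertices of the circuit described at `circuitNext`. -/
def circuit (n : ℕ) (r : ℕ → ZMod 2) : Finset ℕ :=
  (Finset.range (2 * n + 5)).filter fun a => a % 2 = 0 ∨ r (a / 2) ≠ 0

section circuit

variable {n : ℕ} {r : ℕ → ZMod 2}

theorem mem_circuit {a : ℕ} :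
    a ∈ circuit n r ↔ a ≤ 2 * n + 4 ∧ (a % 2 = 0 ∨ r (a / 2) ≠ 0) := by
  rw [circuit, Finset.mem_filter, Finset.mem_range, Nat.lt_succ_iff]

theorem circuitNext_cases {a : ℕ} (ha : a ∈ circuit n r) :
    (a = 2 * n + 4 ∧ circuitNext n r a = 0) ∨
    (a < 2 * n + 4 ∧ a % 2 = 0 ∧ r (a / 2) = 0 ∧ circuitNext n r a = a + 2) ∨
    (a < 2 * n + 4 ∧ a % 2 = 0 ∧ r (a / 2) ≠ 0 ∧ circuitNext n r a = a + 1) ∨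
    (a < 2 * n + 4 ∧ a % 2 = 1 ∧ r (a / 2) ≠ 0 ∧ circuitNext n r a = a + 1) := by
  rw [mem_circuit] at ha
  unfold circuitNext
  by_cases h1 : a = 2 * n + 4
  · simp [h1]
  · have : a < 2 * n + 4 := lt_of_le_of_ne ha.1 h1
    rcases Nat.mod_two_eq_zero_or_one a with h2 | h2
    · by_cases h3 : r (a / 2) = 0 <;> simp [h1, h2, h3, this]
    · have h3 := ha.2.resolve_left (by omega)
      simp [h1, h2, h3, this]

theorem circuitNext_mem {a : ℕ} (ha : a ∈ circuit n r) : circuitNext n r a ∈ circuit n r := by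
  rw [mem_circuit]
  rcases circuitNext_cases ha with ⟨h, h'⟩ | ⟨h, h1, h2, h'⟩ | ⟨h, h1, h2, h'⟩ | ⟨h, h1, h2, h'⟩ <;>
    rw [h']
  · simp
  · exact ⟨by omega, by omega⟩
  · refine ⟨by omega, Or.inr ?_⟩
    rwa [show (a + 1) / 2 = a / 2 by omega]
  · exact ⟨by omega, by omega⟩

theorem circuitNext_injOn : Set.InjOn (circuitNext n r) (circuit n r) := by
  intro a ha b hb hab
  -- The only possible collision: a direct step from `a` and the end of a detour at `a + 1` would
  -- use the same entry of `r`.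
  have key : ∀ {a b : ℕ}, a % 2 = 0 → r (a / 2) = 0 → r (b / 2) ≠ 0 → b % 2 = 1 →
      a + 2 ≠ b + 1 := by
    intro a b h1 h2 h3 h4 h5
    rw [show b / 2 = a / 2 by omega] at h3
    exact h3 h2
  rcases circuitNext_cases ha with ⟨h, h'⟩ | ⟨h, h1, h2, h'⟩ | ⟨h, h1, h2, h'⟩ | ⟨h, h1, h2, h'⟩ <;>
  rcases circuitNext_cases hb with ⟨k, k'⟩ | ⟨k, k1, k2, k'⟩ | ⟨k, k1, k2, k'⟩ | ⟨k, k1, k2, k'⟩ <;>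
  rw [h', k'] at hab
  all_goals first
    | omega
    | exact absurd hab (key h1 h2 k2 k1)
    | exact absurd hab.symm (key k1 k2 h2 h1)

theorem image_circuitNext : (circuit n r).image (circuitNext n r) = circuit n r := by
  refine Finset.eq_of_subset_of_card_le (Finset.image_subset_iff.2 fun a => circuitNext_mem) ?_
  rw [Finset.card_image_of_injOn circuitNext_injOn]

/-- The successor map permutes the circuit, and its only decreasing step ends at `0`; so every other
vertex has a smaller predecessor. -/
theorem eq_apply_zero_of_circuitNext {X : Type*} {f : ℕ → X}
    (hf : ∀ a ∈ circuit n r, f (circuitNext n r a) = f a) :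
    ∀ a ∈ circuit n r, f a = f 0 := by
  intro a
  induction a using Nat.strong_induction_on with
  | _ a ih =>
    intro ha
    rcases Nat.eq_zero_or_pos a with rfl | hpos
    · rfl
    · obtain ⟨b, hb, hba⟩ := Finset.mem_image.1 (image_circuitNext (n := n) (r := r) ▸ ha)
      have hlt : b < a := by
        rcases circuitNext_cases hb with h | h | h | h <;> omega
      rw [← hba, hf b hb, ih b hlt hb]

theorem mem_cone_apex_iff {a u p : ℕ} (hu : u ≤ 2 * n + 4) (hp : 2 * n + 5 ≤ p) :
    (u ∈ ({a, circuitNext n r a, p} : Finset ℕ) ∧ p ∈ ({a, circuitNext n r a, p} : Finset ℕ)) ↔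
      u = a ∨ u = circuitNext n r a := by
  simp only [Finset.mem_insert, Finset.mem_singleton, or_true, and_true]
  constructor
  · rintro (h | h | h)
    · exact Or.inl h
    · exact Or.inr h
    · omega
  · tauto

/-- The second alternative is the closing edge, the only one traversed downwards. -/
theorem mem_cone_base_iff {a u v p : ℕ} (ha : a ∈ circuit n r) (huv : u < v)
    (hv : v ≤ 2 * n + 4) (hp : 2 * n + 5 ≤ p) :
    (u ∈ ({a, circuitNext n r a, p} : Finset ℕ) ∧ v ∈ ({a, circuitNext n r a, p} : Finset ℕ)) ↔
      (a = u ∧ circuitNext n r u = v) ∨ (a = 2 * n + 4 ∧ u = 0 ∧ v = 2 * n + 4) := by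
  simp only [Finset.mem_insert, Finset.mem_singleton]
  constructor
  · rintro ⟨h1 | h1 | h1, h2 | h2 | h2⟩
    all_goals try omega
    · subst h1; exact Or.inl ⟨rfl, h2.symm⟩
    · rcases circuitNext_cases ha with h | h | h | h <;> omega
  · rintro (⟨rfl, h2⟩ | ⟨rfl, rfl, h2⟩)
    · simp [h2]
    · rcases circuitNext_cases ha with h | h | h | h <;> omega

end circuit

/-! ### Ears and cones -/

section family

variable (n : ℕ) {D : ℕ} (r : Fin D → ℕ → ZMod 2)

/-- The triangles `{2 i, 2 i + 1, 2 i + 2}` for `i < n`, and for every `j` the cone with apex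
`2 n + 5 + j` over the circuit belonging to `r j`. -/
def coneFamily : Fin n ⊕ (Σ j : Fin D, {a // a ∈ circuit n (r j)}) → Finset ℕ
  | .inl i => {2 * i.1, 2 * i.1 + 1, 2 * i.1 + 2}
  | .inr ⟨j, a⟩ => {a.1, circuitNext n (r j) a.1, 2 * n + 5 + j.1}

theorem card_coneFamily (k) : (coneFamily n r k).card = 3 := by
  rcases k with i | ⟨j, a, ha⟩
  · exact Finset.card_eq_three.2 ⟨_, _, _, by omega, by omega, by omega, rfl⟩
  · have hle := (mem_circuit.1 ha).1
    refine Finset.card_eq_three.2 ⟨_, _, _, ?_, ?_, ?_, rfl⟩ <;> dsimp only <;>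
      rcases circuitNext_cases ha with h | h | h | h <;> omega

theorem coneFamily_injective : Function.Injective (coneFamily n r) := by
  have apex : ∀ (i : Fin n) (j : Fin D) (a : {a // a ∈ circuit n (r j)}),
      coneFamily n r (.inl i) ≠ coneFamily n r (.inr ⟨j, a⟩) := by
    intro i j a h
    have : 2 * n + 5 + j.1 ∈ coneFamily n r (.inl i) := by rw [h]; simp [coneFamily]
    simp only [coneFamily, Finset.mem_insert, Finset.mem_singleton] at this
    omega
  rintro (i | ⟨j, a, ha⟩) (i' | ⟨j', a', ha'⟩) h
  · have h1 : 2 * i.1 ∈ coneFamily n r (.inl i') := by rw [← h]; simp [coneFamily]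
    have h2 : 2 * i.1 + 2 ∈ coneFamily n r (.inl i') := by rw [← h]; simp [coneFamily]
    simp only [coneFamily, Finset.mem_insert, Finset.mem_singleton] at h1 h2
    rw [Fin.ext (a := i) (b := i') (by omega)]
  · exact absurd h (apex _ _ _)
  · exact absurd h.symm (apex _ _ _)
  · have hle := (mem_circuit.1 ha).1
    have hle' := (mem_circuit.1 ha').1
    have hj : j = j' := by
      have h1 : 2 * n + 5 + j.1 ∈ coneFamily n r (.inr ⟨j', a', ha'⟩) := by
        rw [← h]; simp [coneFamily]
      simp only [coneFamily, Finset.mem_insert, Finset.mem_singleton] at h1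
      have := (mem_circuit.1 (circuitNext_mem ha')).1
      exact Fin.ext (by omega)
    subst hj
    have h1 : a ∈ coneFamily n r (.inr ⟨j, a', ha'⟩) := by rw [← h]; simp [coneFamily]
    have h2 : a' ∈ coneFamily n r (.inr ⟨j, a, ha⟩) := by rw [h]; simp [coneFamily]
    simp only [coneFamily, Finset.mem_insert, Finset.mem_singleton] at h1 h2
    have : a = a' := by
      rcases circuitNext_cases ha with h | h | h | h <;>
      rcases circuitNext_cases ha' with h' | h' | h' | h' <;> omega
    subst this
    rfl

/-- The gap between the two smallest vertices suffices to exclude alternation; an apex exceeds all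
circuit vertices, so it can only be the largest. -/
theorem coneFamily_shape {k} {a b c : ℕ} (ha : a ∈ coneFamily n r k) (hb : b ∈ coneFamily n r k)
    (hc : c ∈ coneFamily n r k) (hab : a < b) (hbc : b < c) :
    b ≤ 2 * n + 4 ∧ (b = a + 1 ∨ (a % 2 = 0 ∧ b = a + 2) ∨ (a = 0 ∧ b = 2 * n + 4)) := by
  rcases k with i | ⟨j, x, hx⟩
  · have := i.2
    simp only [coneFamily, Finset.mem_insert, Finset.mem_singleton] at ha hb hc
    omega
  · simp only [coneFamily, Finset.mem_insert, Finset.mem_singleton] at ha hb hc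
    have hle := (mem_circuit.1 hx).1
    rcases circuitNext_cases hx with h | h | h | h <;> omega

theorem not_alternate_coneFamily (k l) : ¬ Alternate (coneFamily n r k) (coneFamily n r l) := by
  rintro ⟨a, ha, a', ha', b, hb, b', hb', c, hc, c', hc', h1, h2, h3, h4, h5⟩
  have hk := coneFamily_shape n r ha hb hc (h1.trans h2) (h3.trans h4)
  have hl := coneFamily_shape n r ha' hb' hc' (h2.trans h3) (h4.trans h5)
  -- Alternation needs `b ≥ a + 2` and `b' ≥ a' + 2`. If `b = a + 2` with `a` even, then `a' = a +
  -- 1` is odd and admits only `b' = a' + 1`. If `b = 2 * n + 4`, then `b'` is too large.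
  omega

/-! ### Edge sums and cycles of the family -/

theorem sum_coneFamily (y : ℕ → ZMod 2) (f : Fin D → ℕ → ZMod 2)
    {x : Fin n ⊕ (Σ j : Fin D, {a // a ∈ circuit n (r j)}) → ZMod 2}
    (hy : ∀ i, x (.inl i) = y i.1) (hf : ∀ j a, x (.inr ⟨j, a⟩) = f j a.1) (u v : ℕ) :
    ∑ k, (if u ∈ coneFamily n r k ∧ v ∈ coneFamily n r k then x k else 0) =
      ∑ i : Fin n, (if u ∈ ({2 * i.1, 2 * i.1 + 1, 2 * i.1 + 2} : Finset ℕ) ∧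
        v ∈ ({2 * i.1, 2 * i.1 + 1, 2 * i.1 + 2} : Finset ℕ) then y i.1 else 0) +
      ∑ j, ∑ a ∈ circuit n (r j),
        (if u ∈ ({a, circuitNext n (r j) a, 2 * n + 5 + j.1} : Finset ℕ) ∧
          v ∈ ({a, circuitNext n (r j) a, 2 * n + 5 + j.1} : Finset ℕ) then f j a else 0) := by
  rw [Fintype.sum_sum_type, Fintype.sum_sigma]
  congr 1
  · exact Finset.sum_congr rfl fun i _ => by rw [hy]; rfl
  · refine Finset.sum_congr rfl fun j _ => ?_
    rw [← Finset.sum_coe_sort (circuit n (r j))]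
    exact Finset.sum_congr rfl fun a _ => by rw [hf]; rfl

theorem mem_ear_iff {i u v : ℕ} (huv : u < v) :
    (u ∈ ({2 * i, 2 * i + 1, 2 * i + 2} : Finset ℕ) ∧
      v ∈ ({2 * i, 2 * i + 1, 2 * i + 2} : Finset ℕ)) ↔
      i = u / 2 ∧ v ≤ 2 * (u / 2) + 2 := by
  simp only [Finset.mem_insert, Finset.mem_singleton]
  omega

theorem sum_coneFamily_apex {y : ℕ → ZMod 2} {f : Fin D → ℕ → ZMod 2}
    {x : Fin n ⊕ (Σ j : Fin D, {a // a ∈ circuit n (r j)}) → ZMod 2}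
    (hy : ∀ i, x (.inl i) = y i.1) (hf : ∀ j a, x (.inr ⟨j, a⟩) = f j a.1) {u : ℕ}
    (hu : u ≤ 2 * n + 4) (j : Fin D) :
    ∑ k, (if u ∈ coneFamily n r k ∧ 2 * n + 5 + j.1 ∈ coneFamily n r k then x k else 0) =
      ∑ a ∈ circuit n (r j), (if a = u then f j a else 0) +
      ∑ a ∈ circuit n (r j), (if circuitNext n (r j) a = u then f j a else 0) := by
  rw [sum_coneFamily n r y f hy hf, Finset.sum_eq_zero, zero_add, Finset.sum_eq_single j,
    ← Finset.sum_add_distrib]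
  · refine Finset.sum_congr rfl fun a ha => ?_
    simp only [mem_cone_apex_iff hu (show 2 * n + 5 ≤ 2 * n + 5 + j.1 by omega)]
    have hne : a ≠ circuitNext n (r j) a := by
      rcases circuitNext_cases ha with h | h | h | h <;> omega
    by_cases h1 : a = u
    · subst h1
      simp [hne.symm]
    · simp [h1, Ne.symm h1, eq_comm]
  · intro j' _ hj'
    refine Finset.sum_eq_zero fun a ha => if_neg ?_
    rintro ⟨-, h⟩
    simp only [Finset.mem_insert, Finset.mem_singleton] at h
    have h1 := (mem_circuit.1 ha).1
    have h2 := (mem_circuit.1 (circuitNext_mem ha)).1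
    have h3 : j.1 ≠ j'.1 := fun h => hj' (Fin.ext h.symm)
    omega
  · intro h
    exact absurd (Finset.mem_univ j) h
  · intro i _
    refine if_neg ?_
    rintro ⟨-, h⟩
    simp only [Finset.mem_insert, Finset.mem_singleton] at h
    have := i.2
    omega

theorem sum_coneFamily_base {y : ℕ → ZMod 2} {f : Fin D → ℕ → ZMod 2}
    {x : Fin n ⊕ (Σ j : Fin D, {a // a ∈ circuit n (r j)}) → ZMod 2}
    (hy : ∀ i, x (.inl i) = y i.1) (hf : ∀ j a, x (.inr ⟨j, a⟩) = f j a.1)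
    (hy0 : ∀ i, n ≤ i → y i = 0) {u v : ℕ} (huv : u < v) (hv : v ≤ 2 * n + 4) :
    ∑ k, (if u ∈ coneFamily n r k ∧ v ∈ coneFamily n r k then x k else 0) =
      (if v ≤ 2 * (u / 2) + 2 then y (u / 2) else 0) +
      ∑ j, ((if u ∈ circuit n (r j) ∧ circuitNext n (r j) u = v then f j u else 0) +
        (if u = 0 ∧ v = 2 * n + 4 then f j (2 * n + 4) else 0)) := by
  rw [sum_coneFamily n r y f hy hf]
  congr 1
  · simp only [mem_ear_iff huv]
    by_cases hn : u / 2 < n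
    · rw [Finset.sum_eq_single (⟨u / 2, hn⟩ : Fin n)]
      · simp
      · intro i _ hi
        exact if_neg fun h => hi (Fin.ext h.1)
      · intro h
        exact absurd (Finset.mem_univ _) h
    · rw [hy0 _ (not_lt.1 hn), ite_self]
      refine Finset.sum_eq_zero fun i _ => if_neg ?_
      rintro ⟨h, -⟩
      exact hn (h ▸ i.2)
  · refine Finset.sum_congr rfl fun j _ => ?_
    have key : ∀ a ∈ circuit n (r j),
        (if u ∈ ({a, circuitNext n (r j) a, 2 * n + 5 + j.1} : Finset ℕ) ∧
          v ∈ ({a, circuitNext n (r j) a, 2 * n + 5 + j.1} : Finset ℕ) then f j a else 0) =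
        (if a = u then (if circuitNext n (r j) u = v then f j u else 0) else 0) +
        (if a = 2 * n + 4 then
          (if u = 0 ∧ v = 2 * n + 4 then f j (2 * n + 4) else 0) else 0) := by
      intro a ha
      simp only [mem_cone_base_iff ha huv hv (show 2 * n + 5 ≤ 2 * n + 5 + j.1 by omega)]
      by_cases h1 : a = u
      · have : u ≠ 2 * n + 4 := by omega
        subst h1
        simp [this]
      · by_cases h2 : a = 2 * n + 4
        · subst h2
          simp [h1]
        · simp [h1, h2]
    have hmem : 2 * n + 4 ∈ circuit n (r j) := mem_circuit.2 ⟨le_rfl, Or.inl (by omega)⟩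
    rw [Finset.sum_congr rfl key, Finset.sum_add_distrib, Finset.sum_ite_eq', Finset.sum_ite_eq',
      if_pos hmem]
    simp only [ite_and]

/-- The cycles of the cone family are constant on every cone. -/
theorem exists_coefficients_of_cycle
    {x : Fin n ⊕ (Σ j : Fin D, {a // a ∈ circuit n (r j)}) → ZMod 2}
    (hx : ∀ u v : ℕ, u < v →
      ∑ k, (if u ∈ coneFamily n r k ∧ v ∈ coneFamily n r k then x k else 0) = 0) :
    ∃ c : Fin D → ZMod 2, ∑ j, c j = 0 ∧ (∀ i : Fin n, x (.inl i) = ∑ j, c j * r j i.1) ∧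
      ∀ p, x (.inr p) = c p.1 := by
  let y : ℕ → ZMod 2 := fun i => if h : i < n then x (.inl ⟨i, h⟩) else 0
  let f : Fin D → ℕ → ZMod 2 := fun j a =>
    if h : a ∈ circuit n (r j) then x (.inr ⟨j, a, h⟩) else 0
  have hy : ∀ i, x (.inl i) = y i.1 := fun i => by simp [y]
  have hf : ∀ j a, x (.inr ⟨j, a⟩) = f j a.1 := fun j a => by simp [f]
  have hy0 : ∀ i, n ≤ i → y i = 0 := fun i hi => by simp [y, hi]
  have hconst : ∀ j, ∀ a ∈ circuit n (r j), f j a = f j 0 := by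
    intro j
    refine eq_apply_zero_of_circuitNext fun a ha => ?_
    have ha' := circuitNext_mem ha
    have hle := (mem_circuit.1 ha').1
    -- In cone `j`, the edge from the apex to the successor of `a` lies in just two triangles, those
    -- over `a` and over its successor.
    have h := hx (circuitNext n (r j) a) (2 * n + 5 + j.1) (by omega)
    rw [sum_coneFamily_apex n r hy hf hle, Finset.sum_ite_eq', if_pos ha',
      Finset.sum_eq_single_of_mem a ha, if_pos rfl] at h
    · exact CharTwo.add_eq_zero.1 h
    · intro b hb hba
      exact if_neg fun h => hba (circuitNext_injOn hb ha h)
  refine ⟨fun j => f j 0, ?_, ?_, ?_⟩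
  · have h := hx 0 (2 * n + 4) (by omega)
    rw [sum_coneFamily_base n r hy hf hy0 (by omega) le_rfl, if_neg (by omega), zero_add] at h
    rw [← h]
    refine Finset.sum_congr rfl fun j _ => ?_
    rw [if_neg, if_pos ⟨rfl, rfl⟩, zero_add]
    · exact (hconst j _ (mem_circuit.2 ⟨le_rfl, Or.inl (by omega)⟩)).symm
    · rintro ⟨h0, h1⟩
      rcases circuitNext_cases h0 with h | h | h | h <;> omega
  · intro i
    have hi := i.2
    -- This edge lies in ear `i` and in precisely the cones whose row is nonzero at `i`.
    have h := hx (2 * i.1) (2 * i.1 + 1) (by omega)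
    rw [sum_coneFamily_base n r hy hf hy0 (by omega) (by omega), if_pos (by omega),
      show 2 * i.1 / 2 = i.1 by omega] at h
    rw [hy, CharTwo.add_eq_zero.1 h]
    refine Finset.sum_congr rfl fun j _ => ?_
    have hmem : 2 * i.1 ∈ circuit n (r j) := mem_circuit.2 ⟨by omega, Or.inl (by omega)⟩
    rw [if_neg (show ¬ (2 * i.1 = 0 ∧ 2 * i.1 + 1 = 2 * n + 4) by omega), add_zero,
      hconst j _ hmem]
    rcases circuitNext_cases hmem with h | h | h | h
    · omega
    · rw [show 2 * i.1 / 2 = i.1 by omega] at h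
      rw [if_neg (by omega), h.2.2.1, mul_zero]
    · rw [show 2 * i.1 / 2 = i.1 by omega] at h
      rw [if_pos ⟨hmem, by omega⟩, eq_one_of_ne_zero_zmod_two h.2.2.1, mul_one]
    · omega
  · rintro ⟨j, a⟩
    rw [hf, hconst j _ a.2]

theorem exists_cycle_of_coefficients (hr : ∀ j i, n ≤ i → r j i = 0) {c : Fin D → ZMod 2}
    (hc : ∑ j, c j = 0) :
    ∃ x : Fin n ⊕ (Σ j : Fin D, {a // a ∈ circuit n (r j)}) → ZMod 2,
      (∀ u v : ℕ, u < v →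
        ∑ k, (if u ∈ coneFamily n r k ∧ v ∈ coneFamily n r k then x k else 0) = 0) ∧
      ∀ i : Fin n, x (.inl i) = ∑ j, c j * r j i.1 := by
  let y : ℕ → ZMod 2 := fun i => ∑ j, c j * r j i
  let f : Fin D → ℕ → ZMod 2 := fun j _ => c j
  let x : Fin n ⊕ (Σ j : Fin D, {a // a ∈ circuit n (r j)}) → ZMod 2 :=
    Sum.elim (fun i => y i.1) (fun p => c p.1)
  have hy : ∀ i, x (.inl i) = y i.1 := fun i => rfl
  have hf : ∀ j a, x (.inr ⟨j, a⟩) = f j a.1 := fun j a => rfl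
  have hy0 : ∀ i, n ≤ i → y i = 0 := fun i hi =>
    Finset.sum_eq_zero fun j _ => by rw [hr j i hi, mul_zero]
  refine ⟨x, fun u v huv => ?_, fun i => rfl⟩
  rcases le_or_gt v (2 * n + 4) with hv | hv
  · rw [sum_coneFamily_base n r hy hf hy0 huv hv]
    -- With the ear value split among the rows, row `j` contributes `c j` times a factor independent
    -- of `j`: on detour edges ear and cone cancel, on `{2 i, 2 i + 2}` exactly one of them
    -- contributes. Summing over `j` then uses only `∑ j, c j = 0`.
    have key : ∀ j, (if v ≤ 2 * (u / 2) + 2 then c j * r j (u / 2) else 0) +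
        ((if u ∈ circuit n (r j) ∧ circuitNext n (r j) u = v then c j else 0) +
          (if u = 0 ∧ v = 2 * n + 4 then c j else 0)) =
        c j * ((if u % 2 = 0 ∧ v = u + 2 then 1 else 0) +
          (if u = 0 ∧ v = 2 * n + 4 then 1 else 0)) := by
      intro j
      rw [mul_add, ← add_assoc, mul_ite, mul_ite, mul_one, mul_zero]
      congr 1
      have hcc : c j + c j = 0 := CharTwo.add_self_eq_zero _
      by_cases hu : u ∈ circuit n (r j)
      · rcases circuitNext_cases hu with h | ⟨h, h1, h2, h3⟩ | ⟨h, h1, h2, h3⟩ | ⟨h, h1, h2, h3⟩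
        · omega
        · simp only [h2, mul_zero, ite_self, zero_add, hu, true_and, h3, h1]
          exact if_congr eq_comm rfl rfl
        · rw [eq_one_of_ne_zero_zmod_two h2]
          simp only [mul_one, hu, true_and, h3, h1]
          by_cases hv1 : v = u + 1
          · rw [if_pos (by omega), if_pos hv1.symm, if_neg (by omega), hcc]
          · rw [if_neg (Ne.symm hv1), add_zero]
            exact if_congr (by omega) rfl rfl
        · rw [eq_one_of_ne_zero_zmod_two h2]
          simp only [mul_one, hu, true_and, h3, h1]
          by_cases hv1 : v = u + 1
          · rw [if_pos (by omega), if_pos hv1.symm, if_neg (by omega), hcc]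
          · rw [if_neg (Ne.symm hv1), if_neg (by omega), if_neg (by omega), add_zero]
      · have : u % 2 ≠ 0 ∧ r j (u / 2) = 0 := by
          rw [mem_circuit] at hu
          push Not at hu
          exact hu (by omega)
        simp [hu, this]
    have hsum : (if v ≤ 2 * (u / 2) + 2 then y (u / 2) else 0) =
        ∑ j, (if v ≤ 2 * (u / 2) + 2 then c j * r j (u / 2) else 0) := by
      split_ifs
      · rfl
      · simp
    rw [hsum, ← Finset.sum_add_distrib, Finset.sum_congr rfl fun j _ => key j, ← Finset.sum_mul,
      hc, zero_mul]
  · by_cases hp : u ≤ 2 * n + 4 ∧ ∃ j : Fin D, v = 2 * n + 5 + j.1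
    · obtain ⟨hu, j, rfl⟩ := hp
      rw [sum_coneFamily_apex n r hy hf hu]
      -- Reindexing along the permutation `circuitNext`: the two triangles at an apex edge cancel.
      have : ∑ a ∈ circuit n (r j), (if circuitNext n (r j) a = u then c j else 0) =
          ∑ a ∈ circuit n (r j), (if a = u then c j else 0) := by
        conv_rhs => rw [← image_circuitNext, Finset.sum_image circuitNext_injOn]
      rw [this]
      exact CharTwo.add_self_eq_zero _
    · refine Finset.sum_eq_zero fun k _ => if_neg ?_
      rintro ⟨h1, h2⟩
      apply hp
      rcases k with i | ⟨j, a, ha⟩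
      · have := i.2
        simp only [coneFamily, Finset.mem_insert, Finset.mem_singleton] at h1 h2
        omega
      · simp only [coneFamily, Finset.mem_insert, Finset.mem_singleton] at h1 h2
        have h3 := (mem_circuit.1 ha).1
        have h4 := (mem_circuit.1 (circuitNext_mem ha)).1
        exact ⟨by omega, j, by omega⟩

end family

/-! ### Representation of the code -/

theorem theorem4 (n : ℕ) (C : Submodule (ZMod 2) (Fin n → ZMod 2)) :
    ∃ Δ : TriangularConfiguration 4, Δ.IsGeometricRepresentation C := by
  classical
  let b := Module.finBasis (ZMod 2) C
  let R : Fin (Module.finrank (ZMod 2) C + 1) → Fin n → ZMod 2 := Fin.cons 0 fun j => (b j).1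
  let r : Fin (Module.finrank (ZMod 2) C + 1) → ℕ → ZMod 2 := fun j i =>
    if h : i < n then R j ⟨i, h⟩ else 0
  have hrR : ∀ j (i : Fin n), r j i.1 = R j i := fun j i => by simp [r]
  have hr : ∀ j i, n ≤ i → r j i = 0 := fun j i hi => by simp [r, hi]
  have hcomb : ∀ c : Fin (Module.finrank (ZMod 2) C + 1) → ZMod 2,
      (fun i : Fin n => ∑ j, c j * r j i.1) = (∑ j, c (Fin.succ j) • b j : C) := by
    intro c
    ext i
    simp [Fin.sum_univ_succ, hrR, R, Finset.sum_apply]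
  have : Nonempty (Fin n ⊕ (Σ j, {a // a ∈ circuit n (r j)})) :=
    ⟨.inr ⟨0, 0, mem_circuit.2 ⟨by omega, Or.inl rfl⟩⟩⟩
  refine ⟨momentConfiguration (coneFamily n r) (card_coneFamily n r) (not_alternate_coneFamily n r),
    isGeometricRepresentation_momentConfiguration _ _ (coneFamily_injective n r) Sum.inl
      Sum.inl_injective C ?_ ?_ ?_⟩
  · intro x hx h0
    obtain ⟨c, hc, h1, h2⟩ := exists_coefficients_of_cycle n r hx
    have hz : ∑ j, c (Fin.succ j) • b j = 0 := by
      apply Subtype.ext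
      rw [← hcomb]
      ext i
      simpa [h0] using (h1 i).symm
    have hs := Fintype.linearIndependent_iff.1 b.linearIndependent _ hz
    have hc0 : ∀ j, c j = 0 := by
      rw [Fin.sum_univ_succ] at hc
      simp only [hs, Finset.sum_const_zero, add_zero] at hc
      exact Fin.cases hc hs
    ext (i | p)
    · exact h0 i
    · rw [h2, hc0]; rfl
  · intro x hx
    obtain ⟨c, hc, h1, h2⟩ := exists_coefficients_of_cycle n r hx
    rw [funext h1, hcomb]
    exact Subtype.property _
  · intro z hz
    -- The coefficient of the zero row is chosen to make the total zero in characteristic two,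
    -- without affecting the codeword.
    let c : Fin (Module.finrank (ZMod 2) C + 1) → ZMod 2 :=
      Fin.cons (∑ j, b.repr ⟨z, hz⟩ j) fun j => b.repr ⟨z, hz⟩ j
    obtain ⟨x, hx, h1⟩ := exists_cycle_of_coefficients n r hr (c := c)
      (by simp [Fin.sum_univ_succ, c, CharTwo.add_self_eq_zero])
    refine ⟨x, hx, fun i => ?_⟩
    rw [h1]
    have := congrFun (hcomb c) i
    rw [this]
    simp [c, b.sum_repr]
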